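/- All graphs are finite, simple and undirected. Let $G=(V,E)$ be a connected bipartite graph with bipartition $V=V_1\cup V_2$ ($V_1\cap V_2=\emptyset$, every edge joins $V_1$ and $V_2$), let $n=|V|$, and let $1\le k\le n$. Amnesiac flooding on $G$ started by a set $S\subseteq V$ is the following synchronous process: in round $1$ every node of $S$ sends the message to all its neighbors; in every later round, each node that received at least one message in the previous round sends the message to exactly those of its neighbors from which it did not receive the message in the previous round. Let $\mathrm{Flood}_G(S)$ be the number of rounds until termination, i.e. the least $N\ge 0$ such that no message is sent after round $N$, and let $\mathrm{Flood}_k(G)=\min\{\mathrm{Flood}_G(S) : S\subseteq V,\ |S|=k\}$. For $U\subseteq V$ let $d_G(U)=\max_{v\in V}\min_{u\in U} d_G(v,u)$, where $d_G(v,u)$ is the graph distance. The $k$-radius is $r_k(G)=\min\{d_G(U) : U\subseteq V,\ |U|=k\}$, and a $k$-center of $G$ is a set $U\subseteq V$ with $|U|=k$ and $d_G(U)=r_k(G)$. Then: (1) $\mathrm{Flood}_k(G)=r_k(G)$ if and only if $G$ has a $k$-center $S$ with $S\subseteq V_1$ or $S\subseteq V_2$. (2) If $k\le\max(|V_1|,|V_2|)$,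 then $\mathrm{Flood}_k(G)-r_k(G)\le 1$. (3) In all cases, $\mathrm{Flood}_k(G)-r_k(G)\le 2$. -/

import Mathlib

namespace AmnesiacFlooding

variable {V : Type*} (G : SimpleGraph V)

/-- `Sends G S i u v`: in round `i` of synchronous amnesiac flooding on `G` started by all nodes
of `S`, node `u` sends the message to node `v`. Rounds are numbered from `1`; nothing is sent in
"round `0`". In round `1` every node of `S` sends to all its neighbors. In each later round a node
that received at least one message in the previous round sends to exactly those neighbors from
which it received no message in the previous round. -/
def Sends (S : Finset V) : ℕ → V → V → Prop
  | 0 => fun _ _ => False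
  | 1 => fun u v => u ∈ S ∧ G.Adj u v
  | i + 2 => fun u v =>
      G.Adj u v ∧ (∃ w, Sends S (i + 1) w u) ∧ ¬ Sends S (i + 1) v u

/-- The number of rounds that amnesiac flooding started by `S` needs to terminate: the least `N`
such that no message is sent in any round after round `N` (and `⊤` if there is no such `N`). -/
noncomputable def floodTime (S : Finset V) : ℕ∞ :=
  ⨅ (N : ℕ) (_ : ∀ i, N < i → ∀ u v, ¬ Sends G S i u v), (N : ℕ∞)

/-- The minimum of `floodTime G S` over all node sets `S` of size `k`. -/
noncomputable def floodK (k : ℕ) : ℕ∞ :=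
  ⨅ (S : Finset V) (_ : S.card = k), floodTime G S

/-- The distance from the node `v` to the node set `U`. -/
noncomputable def distToSet (v : V) (U : Finset V) : ℕ∞ :=
  ⨅ u ∈ U, G.edist v u

/-- The maximum distance of a node of the graph to the node set `U`. -/
noncomputable def setEcc (U : Finset V) : ℕ∞ :=
  ⨆ v : V, distToSet G v U

/-- The `k`-radius: the minimum of `setEcc G U` over all node sets `U` of size `k`. -/
noncomputable def kRadius (k : ℕ) : ℕ∞ :=
  ⨅ (U : Finset V) (_ : U.card = k), setEcc G U

/-- `U` is a `k`-center: a set of `k` nodes that attains the `k`-radius. -/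
def IsKCenter (k : ℕ) (U : Finset V) : Prop :=
  U.card = k ∧ setEcc G U = kRadius G k

end AmnesiacFlooding

namespace AmnesiacFlooding

variable {V : Type*} {G : SimpleGraph V}

/-! Split `S` into its two colour parts. The distance from a node to one part has a parity fixed by
the two colours, so the waves from the two parts never reach a node in the same round, and each runs
as a breadth-first search (`sends_succ_iff`). Hence the flooding time is the larger eccentricity of
the nonempty parts (`floodTime_le_coe_iff`): at least that of `S`, with equality if `S` lies in one
class.

(1) A nonempty part of an optimal `S` is itself within the radius, so it can be padded inside its
class to a `k`-center if the class is large enough; otherwise the radius is tiny. (2) Shifting each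
center node by at most one edge puts a `k`-center into a class with at least `k` nodes. (3) If both
classes have fewer than `k` nodes, then `k` nodes suffice for each part to have eccentricity at most
three, which is enough unless the radius is zero. -/

theorem distToSet_le_coe_iff (hconn : G.Connected) {v : V} {A : Finset V} {n : ℕ} :
    distToSet G v A ≤ n ↔ ∃ u ∈ A, G.dist v u ≤ n := by
  have hcoe (u : V) : G.edist v u = (G.dist v u : ℕ∞) := (hconn v u).coe_dist_eq_edist.symm
  constructor
  · intro h
    have hA : A.Nonempty := by
      rw [Finset.nonempty_iff_ne_empty]
      rintro rfl
      simp [distToSet] at h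
    obtain ⟨u, hu, hmin⟩ := A.exists_min_image (fun u ↦ G.dist v u) hA
    refine ⟨u, hu, ?_⟩
    have : (G.dist v u : ℕ∞) ≤ distToSet G v A :=
      le_iInf₂ fun w hw ↦ by rw [hcoe w]; exact_mod_cast hmin w hw
    exact_mod_cast this.trans h
  · rintro ⟨u, hu, h⟩
    refine (iInf₂_le u hu).trans ?_
    rw [hcoe u]
    exact_mod_cast h

theorem exists_distToSet_eq_coe (hconn : G.Connected) (v : V) {A : Finset V} (hA : A.Nonempty) :
    ∃ i : ℕ, distToSet G v A = i := by
  obtain ⟨u, hu⟩ := hA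
  have h : distToSet G v A ≤ (G.dist v u : ℕ) := (distToSet_le_coe_iff hconn).2 ⟨u, hu, le_rfl⟩
  obtain ⟨i, hi⟩ := ENat.ne_top_iff_exists.1 (ne_top_of_le_ne_top (ENat.natCast_ne_top _) h)
  exact ⟨i, hi.symm⟩

theorem distToSet_eq_coe_iff (hconn : G.Connected) {v : V} {A : Finset V} {n : ℕ} :
    distToSet G v A = n ↔ (∃ u ∈ A, G.dist v u = n) ∧ ∀ u ∈ A, n ≤ G.dist v u := by
  constructor
  · intro h
    have hle (u : V) (hu : u ∈ A) : n ≤ G.dist v u := by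
      have := (distToSet_le_coe_iff hconn (n := G.dist v u)).2 ⟨u, hu, le_rfl⟩
      rw [h] at this
      exact_mod_cast this
    obtain ⟨u, hu, hun⟩ := (distToSet_le_coe_iff hconn).1 h.le
    exact ⟨⟨u, hu, hun.antisymm (hle u hu)⟩, hle⟩
  · rintro ⟨⟨u, hu, hun⟩, h⟩
    refine le_antisymm ((distToSet_le_coe_iff hconn).2 ⟨u, hu, hun.le⟩) (le_iInf₂ fun w hw ↦ ?_)
    rw [← (hconn v w).coe_dist_eq_edist]
    exact_mod_cast h w hw

theorem distToSet_le_add_one (hconn : G.Connected) {u v : V} (h : G.Adj u v) {A : Finset V}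
    {i j : ℕ} (hu : distToSet G u A = i) (hv : distToSet G v A = j) : j ≤ i + 1 := by
  obtain ⟨⟨w, hw, hwi⟩, -⟩ := (distToSet_eq_coe_iff hconn).1 hu
  have h1 := ((distToSet_eq_coe_iff hconn).1 hv).2 w hw
  have h2 : G.dist v w ≤ G.dist v u + G.dist u w := hconn.dist_triangle
  have h3 : G.dist v u = 1 := SimpleGraph.dist_eq_one_iff_adj.2 h.symm
  omega

theorem exists_adj_dist_eq (hconn : G.Connected) {u w : V} {i : ℕ} (h : G.dist u w = i + 1) :
    ∃ x, G.Adj u x ∧ G.dist x w = i := by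
  obtain ⟨p, hp⟩ := hconn.exists_walk_length_eq_dist u w
  rw [h] at hp
  cases p with
  | nil => simp at hp
  | @cons _ x _ hux q =>
    refine ⟨x, hux, ?_⟩
    simp only [SimpleGraph.Walk.length_cons, Nat.add_right_cancel_iff] at hp
    have h1 := SimpleGraph.dist_le q
    have h2 : G.dist u w ≤ G.dist u x + G.dist x w := hconn.dist_triangle
    have h3 : G.dist u x = 1 := SimpleGraph.dist_eq_one_iff_adj.2 hux
    omega

/-- Walk `m` steps along a geodesic towards `r`. -/
theorem exists_dist_le_of_le_dist (hconn : G.Connected) (r : V) (m : ℕ) :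
    ∀ {v : V}, m ≤ G.dist v r → ∃ x, G.dist v x ≤ m ∧ G.dist x r + m = G.dist v r := by
  induction m with
  | zero => exact fun {v} _ ↦ ⟨v, by simp⟩
  | succ m ih =>
    intro v hm
    obtain ⟨i, hi⟩ := Nat.exists_eq_add_of_lt (Nat.lt_of_succ_le hm)
    obtain ⟨y, hvy, hy⟩ := exists_adj_dist_eq hconn hi
    obtain ⟨x, hx, hxr⟩ := ih (v := y) (by omega)
    have h2 : G.dist v x ≤ G.dist v y + G.dist y x := hconn.dist_triangle
    have h3 : G.dist v y = 1 := SimpleGraph.dist_eq_one_iff_adj.2 hvy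
    exact ⟨x, by omega, by omega⟩

theorem exists_adj_distToSet_eq (hconn : G.Connected) {u : V} {A : Finset V} {i : ℕ}
    (h : distToSet G u A = (i + 1 : ℕ)) : ∃ x, G.Adj u x ∧ distToSet G x A = i := by
  obtain ⟨⟨w, hw, hwi⟩, hle⟩ := (distToSet_eq_coe_iff hconn).1 h
  obtain ⟨x, hux, hx⟩ := exists_adj_dist_eq hconn hwi
  refine ⟨x, hux, (distToSet_eq_coe_iff hconn).2 ⟨⟨w, hw, hx⟩, fun y hy ↦ ?_⟩⟩
  have h1 := hle y hy
  have h2 : G.dist u y ≤ G.dist u x + G.dist x y := hconn.dist_triangle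
  have h3 : G.dist u x = 1 := SimpleGraph.dist_eq_one_iff_adj.2 hux
  omega

/-! ### Parity of distances and the two waves -/

theorem even_dist_iff (hconn : G.Connected) (c : G.Coloring Bool) (u v : V) :
    Even (G.dist u v) ↔ c u = c v := by
  obtain ⟨p, hp⟩ := hconn.exists_walk_length_eq_dist u v
  rw [← hp, c.even_length_iff_congr p, ← Bool.eq_iff_iff]

theorem even_distToSet_iff (hconn : G.Connected) (c : G.Coloring Bool) {A : Finset V} {b : Bool}
    (hA : ∀ u ∈ A, c u = b) {v : V} {i : ℕ} (h : distToSet G v A = i) : Even i ↔ c v = b := by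
  obtain ⟨⟨w, hw, rfl⟩, -⟩ := (distToSet_eq_coe_iff hconn).1 h
  rw [even_dist_iff hconn c, hA w hw]

/-- The nodes of `S` that have colour `b`. -/
def colorPart (c : G.Coloring Bool) (S : Finset V) (b : Bool) : Finset V :=
  S.filter (c · = b)

theorem mem_colorPart {c : G.Coloring Bool} {S : Finset V} {b : Bool} {v : V} :
    v ∈ colorPart c S b ↔ v ∈ S ∧ c v = b := by
  simp [colorPart]

theorem colorPart_subset (c : G.Coloring Bool) (S : Finset V) (b : Bool) : colorPart c S b ⊆ S :=
  Finset.filter_subset _ _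

theorem colorPart_mono (c : G.Coloring Bool) {S T : Finset V} (h : S ⊆ T) (b : Bool) :
    colorPart c S b ⊆ colorPart c T b :=
  Finset.filter_subset_filter _ h

theorem card_colorPart_add_card_colorPart (c : G.Coloring Bool) (S : Finset V) (b : Bool) :
    (colorPart c S b).card + (colorPart c S !b).card = S.card := by
  rw [← S.card_filter_add_card_filter_not (c · = b)]
  simp only [colorPart, Bool.not_eq, ← Bool.not_eq_eq_eq_not, ne_eq]

/-- The messages originating from the two colour classes do not interact: each class floods the
graph like a breadth-first search. -/
theorem sends_succ_iff (hconn : G.Connected) (c : G.Coloring Bool) (S : Finset V) (i : ℕ)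
    (u v : V) : Sends G S (i + 1) u v ↔ G.Adj u v ∧ ∃ b,
      distToSet G u (colorPart c S b) = i ∧ distToSet G v (colorPart c S b) = (i + 1 : ℕ) := by
  have hcol (b : Bool) : ∀ u ∈ colorPart c S b, c u = b := fun u hu ↦ (mem_colorPart.1 hu).2
  induction i generalizing u v with
  | zero =>
    simp only [Sends]
    constructor
    · rintro ⟨hu, huv⟩
      have hmem : u ∈ colorPart c S (c u) := mem_colorPart.2 ⟨hu, rfl⟩
      refine ⟨huv, c u, (distToSet_eq_coe_iff hconn).2 ⟨⟨u, hmem, by simp⟩, by simp⟩,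
        (distToSet_eq_coe_iff hconn).2
          ⟨⟨u, hmem, SimpleGraph.dist_eq_one_iff_adj.2 huv.symm⟩, fun w hw ↦ ?_⟩⟩
      refine hconn.pos_dist_of_ne ?_
      rintro rfl
      exact c.valid huv (hcol _ _ hw).symm
    · rintro ⟨huv, b, hu, -⟩
      obtain ⟨⟨w, hw, hwu⟩, -⟩ := (distToSet_eq_coe_iff hconn).1 hu
      obtain rfl := hconn.dist_eq_zero_iff.1 hwu
      exact ⟨colorPart_subset _ _ _ hw, huv⟩
  | succ i ih =>
    simp only [Sends, ih]
    constructor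
    · rintro ⟨huv, ⟨w, -, b, -, hu⟩, hnot⟩
      refine ⟨huv, b, hu, ?_⟩
      have hne : (colorPart c S b).Nonempty :=
        let ⟨⟨x, hx, _⟩, _⟩ := (distToSet_eq_coe_iff hconn).1 hu
        ⟨x, hx⟩
      obtain ⟨j, hj⟩ := exists_distToSet_eq_coe hconn v hne
      have h1 := distToSet_le_add_one hconn huv hu hj
      have h2 := distToSet_le_add_one hconn huv.symm hj hu
      have h3 : j ≠ i := by
        rintro rfl
        exact hnot ⟨huv.symm, b, hj, hu⟩
      -- Equal distances to one part would give adjacent nodes the same colour.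
      have h4 : j ≠ i + 1 := by
        rintro rfl
        have e1 := even_distToSet_iff hconn c (hcol b) hu
        have e2 := even_distToSet_iff hconn c (hcol b) hj
        have := c.valid huv
        rw [e1] at e2
        revert e2 this
        cases c u <;> cases c v <;> cases b <;> simp
      rw [hj]
      congr 1
      omega
    · rintro ⟨huv, b, hu, hv⟩
      refine ⟨huv, ?_, ?_⟩
      · obtain ⟨w, huw, hw⟩ := exists_adj_distToSet_eq hconn hu
        exact ⟨w, huw.symm, b, hw, hu⟩
      · rintro ⟨-, b', hv', hu'⟩
        -- Node `u` is at distance `i + 1` from both parts, so parity forces the parts to coincide.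
        have hb : b' = b := by
          have e1 := even_distToSet_iff hconn c (hcol b) hu
          have e2 := even_distToSet_iff hconn c (hcol b') hu'
          rw [e1] at e2
          revert e2
          cases c u <;> cases b <;> cases b' <;> simp
        subst hb
        rw [hv] at hv'
        have : i + 1 + 1 = i := by exact_mod_cast hv'
        omega

/-! ### Flooding time and eccentricity -/

theorem floodTime_le_coe_iff_forall_not_sends {S : Finset V} {N : ℕ} :
    floodTime G S ≤ N ↔ ∀ i, N < i → ∀ u v, ¬ Sends G S i u v := by
  constructor
  · intro h
    by_contra hN
    have : ((N + 1 : ℕ) : ℕ∞) ≤ floodTime G S := by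
      refine le_iInf₂ fun M hM ↦ ?_
      by_contra hlt
      have hMN : M ≤ N := by
        have : M < N + 1 := by exact_mod_cast not_le.1 hlt
        omega
      exact hN fun i hi ↦ hM i (hMN.trans_lt hi)
    have : N + 1 ≤ N := by exact_mod_cast this.trans h
    omega
  · exact fun h ↦ iInf₂_le N h

/-- The flooding time in a connected bipartite graph is the larger one of the eccentricities of the
nonempty colour parts of the starting set. -/
theorem floodTime_le_coe_iff (hconn : G.Connected) (c : G.Coloring Bool) {S : Finset V} {N : ℕ} :
    floodTime G S ≤ N ↔
      ∀ b, (colorPart c S b).Nonempty → setEcc G (colorPart c S b) ≤ N := by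
  rw [floodTime_le_coe_iff_forall_not_sends]
  constructor
  · refine fun h b hb ↦ iSup_le fun v ↦ ?_
    by_contra hlt
    obtain ⟨j, hj⟩ := exists_distToSet_eq_coe hconn v hb
    rw [hj] at hlt
    have hNj : N < j := by exact_mod_cast not_le.1 hlt
    obtain ⟨i, rfl⟩ : ∃ i, j = i + 1 := ⟨j - 1, by omega⟩
    obtain ⟨w, hvw, hw⟩ := exists_adj_distToSet_eq hconn hj
    exact h _ hNj w v ((sends_succ_iff hconn c S i w v).2 ⟨hvw.symm, b, hw, hj⟩)
  · intro h i hi u v hs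
    obtain ⟨i, rfl⟩ : ∃ j, i = j + 1 := ⟨i - 1, by omega⟩
    obtain ⟨-, b, hu, hv⟩ := (sends_succ_iff hconn c S i u v).1 hs
    have hne : (colorPart c S b).Nonempty :=
      let ⟨⟨x, hx, _⟩, _⟩ := (distToSet_eq_coe_iff hconn).1 hu
      ⟨x, hx⟩
    have : distToSet G v (colorPart c S b) ≤ N := (le_iSup (distToSet G · _) v).trans (h b hne)
    rw [hv] at this
    have : i + 1 ≤ N := by exact_mod_cast this
    omega

theorem setEcc_anti {A B : Finset V} (h : A ⊆ B) : setEcc G B ≤ setEcc G A :=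
  iSup_mono fun _ ↦ iInf_le_iInf_of_subset h

theorem setEcc_le_coe_iff (hconn : G.Connected) {A : Finset V} {n : ℕ} :
    setEcc G A ≤ n ↔ ∀ v, ∃ u ∈ A, G.dist v u ≤ n := by
  simp only [setEcc, iSup_le_iff, distToSet_le_coe_iff hconn]

theorem floodTime_le_of_forall_color_eq (hconn : G.Connected) (c : G.Coloring Bool)
    {S : Finset V} {b : Bool} (hS : ∀ v ∈ S, c v = b) {N : ℕ} (h : setEcc G S ≤ N) :
    floodTime G S ≤ N := by
  refine (floodTime_le_coe_iff hconn c).2 fun b' ⟨x, hx⟩ ↦ ?_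
  obtain ⟨hxS, hxb⟩ := mem_colorPart.1 hx
  have : colorPart c S b' = S := by
    refine Finset.filter_true_of_mem fun v hv ↦ ?_
    rw [hS v hv, ← hxb, hS x hxS]
  rwa [this]

/-- A part of `S` has at least the eccentricity of `S`. The empty set floods in zero rounds but has
eccentricity `⊤`. -/
theorem setEcc_le_floodTime (hconn : G.Connected) (c : G.Coloring Bool) {S : Finset V}
    (hS : S.Nonempty) : setEcc G S ≤ floodTime G S := by
  induction h : floodTime G S with
  | top => exact le_top
  | coe N =>
    obtain ⟨x, hx⟩ := hS
    have hne : (colorPart c S (c x)).Nonempty := ⟨x, mem_colorPart.2 ⟨hx, rfl⟩⟩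
    exact (setEcc_anti (colorPart_subset c S _)).trans
      ((floodTime_le_coe_iff hconn c).1 h.le _ hne)

theorem exists_card_eq_and_eq_iInf [Fintype V] (f : Finset V → ℕ∞) {k : ℕ}
    (hk : k ≤ Fintype.card V) :
    ∃ S : Finset V, S.card = k ∧ f S = ⨅ (T : Finset V) (_ : T.card = k), f T := by
  obtain ⟨S₀, -, hS₀⟩ := Finset.exists_subset_card_eq (s := (Finset.univ : Finset V)) hk
  have : Nonempty {S : Finset V // S.card = k} := ⟨⟨S₀, hS₀⟩⟩
  obtain ⟨⟨S, hS⟩, h⟩ := ciInf_mem fun T : {S : Finset V // S.card = k} ↦ f T.1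
  exact ⟨S, hS, by rw [← iInf_subtype' (f := fun T (_ : T.card = k) ↦ f T)] at h; exact h⟩

theorem floodK_le_floodTime {k : ℕ} {S : Finset V} (hS : S.card = k) :
    floodK G k ≤ floodTime G S :=
  iInf₂_le S hS

theorem kRadius_le_setEcc {k : ℕ} {S : Finset V} (hS : S.card = k) :
    kRadius G k ≤ setEcc G S :=
  iInf₂_le S hS

theorem kRadius_le_floodK (hconn : G.Connected) (c : G.Coloring Bool) {k : ℕ} (hk : 1 ≤ k) :
    kRadius G k ≤ floodK G k :=
  le_iInf₂ fun _ hS ↦ (kRadius_le_setEcc hS).trans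
    (setEcc_le_floodTime hconn c (Finset.card_pos.1 (by omega)))

theorem exists_adj_of_ne (hconn : G.Connected) {u v : V} (h : u ≠ v) : ∃ w, G.Adj u w := by
  have := hconn.pos_dist_of_ne h
  obtain ⟨w, hw, -⟩ := exists_adj_dist_eq hconn (u := u) (w := v) (i := G.dist u v - 1) (by omega)
  exact ⟨w, hw⟩

/-- Nodes of the same colour are at even distance, so distance at most one means equality. -/
theorem mem_of_setEcc_colorPart_le_one (hconn : G.Connected) (c : G.Coloring Bool) {S : Finset V}
    {b : Bool} (h : setEcc G (colorPart c S b) ≤ (1 : ℕ)) {v : V} (hv : c v = b) : v ∈ S := by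
  obtain ⟨u, hu, huv⟩ := (setEcc_le_coe_iff hconn).1 h v
  obtain ⟨huS, hub⟩ := mem_colorPart.1 hu
  have he : Even (G.dist v u) := (even_dist_iff hconn c v u).2 (hv.trans hub.symm)
  have h0 : G.dist v u = 0 := by
    rcases he with ⟨m, hm⟩
    omega
  rwa [hconn.dist_eq_zero_iff.1 h0]

section Finite

variable [Fintype V]

theorem exists_setEcc_eq_coe (hconn : G.Connected) {A : Finset V} (hA : A.Nonempty) :
    ∃ n : ℕ, setEcc G A = n := by
  obtain ⟨a, ha⟩ := hA
  have h : setEcc G A ≤ (∑ v, G.dist v a : ℕ) := (setEcc_le_coe_iff hconn).2 fun v ↦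
    ⟨a, ha, Finset.single_le_sum (f := (G.dist · a)) (fun _ _ ↦ Nat.zero_le _) (Finset.mem_univ v)⟩
  obtain ⟨i, hi⟩ := ENat.ne_top_iff_exists.1 (ne_top_of_le_ne_top (ENat.natCast_ne_top _) h)
  exact ⟨i, hi.symm⟩

theorem exists_isKCenter (k : ℕ) (hk : k ≤ Fintype.card V) : ∃ U : Finset V, IsKCenter G k U :=
  exists_card_eq_and_eq_iInf (setEcc G) hk

theorem exists_kRadius_eq_coe (hconn : G.Connected) {k : ℕ} (hk : 1 ≤ k)
    (hkn : k ≤ Fintype.card V) : ∃ r : ℕ, kRadius G k = r := by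
  obtain ⟨U, hU, hUr⟩ := exists_isKCenter (G := G) k hkn
  rw [← hUr]
  exact exists_setEcc_eq_coe hconn (Finset.card_pos.1 (by omega))

theorem exists_adj_colorPart (hconn : G.Connected) (c : G.Coloring Bool) {b : Bool}
    (hb : (colorPart c Finset.univ b).Nonempty) {v : V} (hv : c v ≠ b) :
    ∃ w, G.Adj v w ∧ c w = b := by
  obtain ⟨x, hx⟩ := hb
  obtain ⟨w, hw⟩ := exists_adj_of_ne hconn (u := v) (v := x) fun h ↦
    hv (h ▸ (mem_colorPart.1 hx).2)
  refine ⟨w, hw, ?_⟩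
  have := c.valid hw
  revert hv this
  cases c v <;> cases c w <;> cases b <;> simp

theorem setEcc_colorPart_univ_le_one (hconn : G.Connected) (c : G.Coloring Bool) {b : Bool}
    (hb : (colorPart c Finset.univ b).Nonempty) :
    setEcc G (colorPart c Finset.univ b) ≤ (1 : ℕ) := by
  refine (setEcc_le_coe_iff hconn).2 fun v ↦ ?_
  by_cases hv : c v = b
  · exact ⟨v, mem_colorPart.2 ⟨Finset.mem_univ v, hv⟩, by simp⟩
  · obtain ⟨w, hvw, hw⟩ := exists_adj_colorPart hconn c hb hv
    exact ⟨w, mem_colorPart.2 ⟨Finset.mem_univ w, hw⟩, (SimpleGraph.dist_eq_one_iff_adj.2 hvw).le⟩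

theorem eq_univ_of_setEcc_eq_zero (hconn : G.Connected) {U : Finset V} (h : setEcc G U = 0) :
    U = Finset.univ := by
  refine Finset.eq_univ_of_forall fun v ↦ ?_
  obtain ⟨u, hu, huv⟩ := (setEcc_le_coe_iff hconn (n := 0)).1 h.le v
  rwa [hconn.dist_eq_zero_iff.1 (Nat.le_zero.1 huv)]

/-- Padding inside the class cannot increase the eccentricity. -/
theorem exists_isKCenter_of_subset_colorPart (c : G.Coloring Bool) {k : ℕ} {A : Finset V}
    {b : Bool} (hA : A ⊆ colorPart c Finset.univ b) (hAk : A.card ≤ k)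
    (hk : k ≤ (colorPart c Finset.univ b).card) (h : setEcc G A ≤ kRadius G k) :
    ∃ S : Finset V, IsKCenter G k S ∧ ∃ b, ∀ v ∈ S, c v = b := by
  obtain ⟨S, hAS, hSb, hS⟩ := Finset.exists_subsuperset_card_eq hA hAk hk
  exact ⟨S, ⟨hS, ((setEcc_anti hAS).trans h).antisymm (kRadius_le_setEcc hS)⟩, b,
    fun v hv ↦ (mem_colorPart.1 (hSb hv)).2⟩

/-! ### The three comparisons with the radius -/

theorem floodK_eq_kRadius_iff (hconn : G.Connected) (c : G.Coloring Bool) {k : ℕ} (hk : 1 ≤ k)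
    (hkn : k ≤ Fintype.card V) :
    floodK G k = kRadius G k ↔ ∃ S : Finset V, IsKCenter G k S ∧ ∃ b, ∀ v ∈ S, c v = b := by
  obtain ⟨r, hr⟩ := exists_kRadius_eq_coe hconn hk hkn
  constructor
  · intro h
    obtain ⟨S, hS, hSf⟩ := exists_card_eq_and_eq_iInf (floodTime G) hkn
    change _ = floodK G k at hSf
    rw [h, hr] at hSf
    have hecc := (floodTime_le_coe_iff hconn c).1 hSf.le
    obtain ⟨x, hx⟩ : S.Nonempty := Finset.card_pos.1 (by omega)
    have hne : (colorPart c S (c x)).Nonempty := ⟨x, mem_colorPart.2 ⟨hx, rfl⟩⟩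
    by_cases hlarge : ∃ b, (colorPart c S b).Nonempty ∧ k ≤ (colorPart c Finset.univ b).card
    · obtain ⟨b, hb, hkb⟩ := hlarge
      exact exists_isKCenter_of_subset_colorPart c (colorPart_mono c S.subset_univ b)
        ((Finset.card_le_card (colorPart_subset c S b)).trans hS.le) hkb ((hecc b hb).trans hr.ge)
    push Not at hlarge
    by_cases hne' : (colorPart c S !(c x)).Nonempty
    · -- both colour classes have fewer than `k` nodes, so the radius is at most one
      exfalso
      obtain ⟨T, hT, -, hTk⟩ := Finset.exists_subsuperset_card_eq
        (Finset.subset_univ (colorPart c Finset.univ (c x))) (hlarge _ hne).le hkn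
      have hr1 : (r : ℕ∞) ≤ (1 : ℕ) := by
        rw [← hr]
        exact (kRadius_le_setEcc hTk).trans ((setEcc_anti hT).trans
          (setEcc_colorPart_univ_le_one hconn c ⟨x, mem_colorPart.2 ⟨Finset.mem_univ x, rfl⟩⟩))
      have hSuniv : S = Finset.univ := Finset.eq_univ_of_forall fun v ↦ by
        by_cases hv : c v = c x
        · exact mem_of_setEcc_colorPart_le_one hconn c ((hecc _ hne).trans hr1) hv
        · exact mem_of_setEcc_colorPart_le_one hconn c ((hecc _ hne').trans hr1)
            (Bool.eq_not_iff.2 hv)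
      have hr0 : (r : ℕ∞) ≤ (0 : ℕ) := by
        rw [← hr]
        exact (kRadius_le_setEcc hS).trans
          ((setEcc_le_coe_iff hconn).2 fun v ↦ ⟨v, by simp [hSuniv], by simp⟩)
      -- With radius zero, one colour part alone would be the whole graph, yet the other is
      -- nonempty.
      have h0 := eq_univ_of_setEcc_eq_zero hconn
        (le_antisymm ((hecc _ hne).trans hr0) zero_le)
      obtain ⟨y, hy⟩ := hne'
      have hy1 := (mem_colorPart.1 hy).2
      have hy2 := (mem_colorPart.1 (h0 ▸ Finset.mem_univ y)).2
      simp [hy2] at hy1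
    · have hSx : ∀ v ∈ S, c v = c x := fun v hv ↦ by
        by_contra hvx
        exact hne' ⟨v, mem_colorPart.2 ⟨hv, Bool.eq_not_iff.2 hvx⟩⟩
      refine ⟨S, ⟨hS, le_antisymm ?_ (kRadius_le_setEcc hS)⟩, c x, hSx⟩
      rw [hr, ← hSf]
      exact setEcc_le_floodTime hconn c ⟨x, hx⟩
  · rintro ⟨S, ⟨hS, hSr⟩, b, hb⟩
    refine le_antisymm ?_ (kRadius_le_floodK hconn c hk)
    rw [hr] at hSr ⊢
    exact (floodK_le_floodTime hS).trans (floodTime_le_of_forall_color_eq hconn c hb hSr.le)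

theorem floodK_le_kRadius_add_one [DecidableEq V] (hconn : G.Connected) (c : G.Coloring Bool)
    {k : ℕ} (hk : 1 ≤ k) {b : Bool} (hb : k ≤ (colorPart c Finset.univ b).card) :
    floodK G k ≤ kRadius G k + 1 := by
  have hkn : k ≤ Fintype.card V := hb.trans (Finset.card_le_univ _)
  have hne : (colorPart c Finset.univ b).Nonempty := Finset.card_pos.1 (by omega)
  obtain ⟨r, hr⟩ := exists_kRadius_eq_coe hconn hk hkn
  obtain ⟨U, hU, hUr⟩ := exists_isKCenter (G := G) k hkn
  have hproj (v : V) : ∃ w, c w = b ∧ G.dist v w ≤ 1 := by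
    by_cases hv : c v = b
    · exact ⟨v, hv, by simp⟩
    · obtain ⟨w, hvw, hw⟩ := exists_adj_colorPart hconn c hne hv
      exact ⟨w, hw, (SimpleGraph.dist_eq_one_iff_adj.2 hvw).le⟩
  choose f hfb hfd using hproj
  have hsub : U.image f ⊆ colorPart c Finset.univ b := fun w hw ↦ by
    obtain ⟨u, -, rfl⟩ := Finset.mem_image.1 hw
    exact mem_colorPart.2 ⟨Finset.mem_univ _, hfb u⟩
  obtain ⟨S, hUS, hSb, hS⟩ :=
    Finset.exists_subsuperset_card_eq hsub (Finset.card_image_le.trans hU.le) hb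
  have hecc : setEcc G S ≤ (r + 1 : ℕ) := (setEcc_le_coe_iff hconn).2 fun v ↦ by
    obtain ⟨u, hu, huv⟩ := (setEcc_le_coe_iff hconn).1 (hUr.trans hr).le v
    have h1 : G.dist v (f u) ≤ G.dist v u + G.dist u (f u) := hconn.dist_triangle
    have h2 := hfd u
    exact ⟨f u, hUS (Finset.mem_image_of_mem f hu), by omega⟩
  rw [hr]
  exact_mod_cast (floodK_le_floodTime hS).trans (floodTime_le_of_forall_color_eq hconn c
    (fun v hv ↦ (mem_colorPart.1 (hSb hv)).2) hecc)

/-- Of the nodes in every other layer around a root, about half suffice to reach every node within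
distance three: take the layers in a suitable residue class modulo four. -/
theorem exists_subset_colorPart_setEcc_le_three [DecidableEq V] (hconn : G.Connected)
    (c : G.Coloring Bool) {b : Bool} (hb : (colorPart c Finset.univ b).Nonempty) :
    ∃ A ⊆ colorPart c Finset.univ b,
      setEcc G A ≤ (3 : ℕ) ∧ 2 * A.card ≤ (colorPart c Finset.univ b).card + 1 := by
  obtain ⟨r, hr⟩ := hb
  have hrb := (mem_colorPart.1 hr).2
  set T : ℕ → Finset V := fun j ↦ Finset.univ.filter (G.dist · r % 4 = j) with hT
  have hmemT (j : ℕ) (v : V) : v ∈ T j ↔ G.dist v r % 4 = j := by simp [hT]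
  have hcol (v : V) : v ∈ colorPart c Finset.univ b ↔ Even (G.dist v r) := by
    rw [even_dist_iff hconn c, mem_colorPart, hrb]
    simp
  have hdisj : Disjoint (T 0) (T 2) := Finset.disjoint_left.2 fun v h0 h2 ↦ by
    rw [hmemT] at h0 h2
    omega
  have hsub (j : ℕ) (hj : Even j) : T j ⊆ colorPart c Finset.univ b := fun v hv ↦ by
    rw [hmemT] at hv
    rw [hcol]
    grind
  have hcard : (T 0).card + (T 2).card ≤ (colorPart c Finset.univ b).card := by
    rw [← Finset.card_union_of_disjoint hdisj]
    exact Finset.card_le_card (Finset.union_subset (hsub 0 (by decide)) (hsub 2 (by decide)))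
  -- At most three steps towards the root lead to the chosen residue. Nodes at depth at most one
  -- have no layer of residue two above them, hence the extra root; it fits the bound because `T 2`
  -- is then strictly smaller than `T 0`.
  by_cases hlt : (T 0).card ≤ (T 2).card
  · refine ⟨T 0, hsub 0 (by decide), (setEcc_le_coe_iff hconn).2 fun v ↦ ?_, by omega⟩
    obtain ⟨x, hx, hxr⟩ :=
      exists_dist_le_of_le_dist hconn r (G.dist v r % 4) (Nat.mod_le _ _)
    exact ⟨x, (hmemT 0 x).2 (by omega), by omega⟩
  · refine ⟨insert r (T 2), Finset.insert_subset hr (hsub 2 (by decide)),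
      (setEcc_le_coe_iff hconn).2 fun v ↦ ?_, ?_⟩
    · by_cases hv : G.dist v r ≤ 1
      · exact ⟨r, Finset.mem_insert_self _ _, by omega⟩
      · obtain ⟨x, hx, hxr⟩ :=
          exists_dist_le_of_le_dist hconn r ((G.dist v r + 2) % 4) (v := v) (by omega)
        exact ⟨x, Finset.mem_insert_of_mem ((hmemT 2 x).2 (by omega)), by omega⟩
    · have := Finset.card_insert_le r (T 2)
      omega

theorem floodK_le_three [DecidableEq V] (hconn : G.Connected) (c : G.Coloring Bool) {k : ℕ}
    (hkn : k ≤ Fintype.card V) (h : ∀ b, (colorPart c Finset.univ b).card < k) :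
    floodK G k ≤ (3 : ℕ) := by
  have hsum := card_colorPart_add_card_colorPart c Finset.univ true
  rw [Finset.card_univ, Bool.not_true] at hsum
  have htrue := h true
  have hfalse := h false
  have hne (b : Bool) : (colorPart c Finset.univ b).Nonempty :=
    Finset.card_pos.1 (by cases b <;> omega)
  choose A hAsub hA hAcard using fun b ↦ exists_subset_colorPart_setEcc_le_three hconn c (hne b)
  -- Twice the size is at most `n + 2`, and `n ≤ 2 * k - 2` as both classes have fewer than `k`
  -- nodes.
  have hcard : (A true ∪ A false).card ≤ k := by
    have := Finset.card_union_le (A true) (A false)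
    have := hAcard true
    have := hAcard false
    omega
  obtain ⟨S, hAS, -, hS⟩ :=
    Finset.exists_subsuperset_card_eq (Finset.subset_univ (A true ∪ A false)) hcard hkn
  refine (floodK_le_floodTime hS).trans ((floodTime_le_coe_iff hconn c).2 fun b _ ↦
    (setEcc_anti fun v hv ↦ ?_).trans (hA b))
  refine mem_colorPart.2 ⟨hAS ?_, (mem_colorPart.1 (hAsub b hv)).2⟩
  cases b <;> simp [hv]

theorem floodTime_univ_le_one (hconn : G.Connected) (c : G.Coloring Bool) :
    floodTime G Finset.univ ≤ (1 : ℕ) :=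
  (floodTime_le_coe_iff hconn c).2 fun _ hb ↦ setEcc_colorPart_univ_le_one hconn c hb

theorem floodK_le_kRadius_add_two [DecidableEq V] (hconn : G.Connected) (c : G.Coloring Bool)
    {k : ℕ} (hk : 1 ≤ k) (hkn : k ≤ Fintype.card V) : floodK G k ≤ kRadius G k + 2 := by
  by_cases hlarge : ∃ b, k ≤ (colorPart c Finset.univ b).card
  · obtain ⟨b, hb⟩ := hlarge
    exact (floodK_le_kRadius_add_one hconn c hk hb).trans (by gcongr; norm_num)
  push Not at hlarge
  obtain ⟨U, hU, hUr⟩ := exists_isKCenter (G := G) k hkn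
  -- Radius zero forces `k = n`, where the bound three is too weak but one round suffices.
  by_cases h0 : kRadius G k = 0
  · obtain rfl := eq_univ_of_setEcc_eq_zero hconn (hUr.trans h0)
    rw [h0]
    exact (floodK_le_floodTime hU).trans ((floodTime_univ_le_one hconn c).trans (by norm_num))
  · refine (floodK_le_three hconn c hkn hlarge).trans ?_
    calc ((3 : ℕ) : ℕ∞) = 1 + 2 := by norm_num
      _ ≤ kRadius G k + 2 := by
        gcongr
        exact Order.one_le_iff_pos.2 (pos_iff_ne_zero.2 h0)

end Finite

end AmnesiacFlooding

theorem theorem4 {V : Type*} [Fintype V] [DecidableEq V] (G : SimpleGraph V)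
    (hconn : G.Connected) (V₁ V₂ : Finset V)
    (hcover : V₁ ∪ V₂ = Finset.univ)
    (hbip : G.IsBipartiteWith (V₁ : Set V) (V₂ : Set V))
    (k : ℕ) (hk : 1 ≤ k) (hkn : k ≤ Fintype.card V) :
    (AmnesiacFlooding.floodK G k = AmnesiacFlooding.kRadius G k ↔
      ∃ S : Finset V, AmnesiacFlooding.IsKCenter G k S ∧ (S ⊆ V₁ ∨ S ⊆ V₂)) ∧
    (k ≤ max V₁.card V₂.card →
      AmnesiacFlooding.floodK G k ≤ AmnesiacFlooding.kRadius G k + 1) ∧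
    AmnesiacFlooding.floodK G k ≤ AmnesiacFlooding.kRadius G k + 2 := by
  have hdisj : Disjoint V₁ V₂ := Finset.disjoint_coe.1 hbip.disjoint
  have hmem₂ (v : V) : v ∈ V₂ ↔ v ∉ V₁ := by
    have h1 : v ∈ V₁ ∪ V₂ := hcover ▸ Finset.mem_univ v
    exact ⟨fun h ↦ Finset.disjoint_right.1 hdisj h, (Finset.mem_union.1 h1).resolve_left⟩
  let c : G.Coloring Bool := SimpleGraph.Coloring.mk (fun v ↦ decide (v ∈ V₁)) fun {u v} huv ↦ by
    have := hbip.mem_of_adj huv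
    simp only [Finset.mem_coe, hmem₂] at this
    simp only [ne_eq, decide_eq_decide]
    tauto
  have hc (v : V) : c v = decide (v ∈ V₁) := rfl
  have hpart₁ : AmnesiacFlooding.colorPart c Finset.univ true = V₁ := by
    ext v
    simp [AmnesiacFlooding.mem_colorPart, hc]
  have hpart₂ : AmnesiacFlooding.colorPart c Finset.univ false = V₂ := by
    ext v
    simp [AmnesiacFlooding.mem_colorPart, hc, hmem₂]
  refine ⟨?_, fun h ↦ ?_, AmnesiacFlooding.floodK_le_kRadius_add_two hconn c hk hkn⟩
  · rw [AmnesiacFlooding.floodK_eq_kRadius_iff hconn c hk hkn]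
    simp [Finset.subset_iff, hc, hmem₂, or_comm]
  · rcases le_max_iff.1 h with h | h
    · exact AmnesiacFlooding.floodK_le_kRadius_add_one hconn c hk (b := true) (hpart₁ ▸ h)
    · exact AmnesiacFlooding.floodK_le_kRadius_add_one hconn c hk (b := false) (hpart₂ ▸ h)
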